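/- Let $1\le d<n$ be integers, and put $T_{d,k}=1/\sum_{i=1}^{k}(d+1-i)$ for $1\le k\le d$ and $J_m=\sum_{i=1}^m i$ for $m\ge 0$. The size in bits of a finite alphabet is the base-two logarithm of its cardinality. An $(n,d)$ *MLDR code* (multilevel diversity coding with regeneration) stores $d$ independent messages $M_1,\dots,M_d$ of $B_1,\dots,B_d$ bits ($B_k\ge 0$, $\sum_j B_j>0$) in $n$ nodes of capacity $\alpha$ bits each, such that (i) for every $k\in\{1,\dots,d\}$, $M_k$ can be recovered without error from the contents of any $k$ nodes, and (ii) the content of any node can be regenerated exactly from $\beta$ bits sent by each of any $d$ other nodes, where what a helper node sends is a function of its own content (which may depend on the failed node and on the set of helpers). A pair $(\bar\alpha,\bar\beta)$ is *achievable* for $(\bar B_1,\dots,\bar B_d)$ if there is such a code with $\bar B_k=B_k/\sum_jB_j$, $\bar\alpha=\alpha/\sum_jB_j$ and $\bar\beta=\beta/\sum_jB_j$. An $(n,k,d)$ *exact-repair regenerating code* is defined likewise for a single message of $B>0$ bits that can be recovered from any $k$ nodes, with normalized pair $(\alpha/B,\beta/B)$. (For $B=0$ the same definition is used, without normalization.)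 The *MBR point* of either problem is the achievable pair with the least $\bar\beta$ and, among the achievable pairs with that $\bar\beta$, the least $\bar\alpha$; a code whose own normalized pair is the MBR point is an *MBR code*. *Separate coding* encodes each $M_k$ by an $(n,k,d)$ exact-repair regenerating code of its own; node contents and helper data are the tuples of those of the $d$ codes. Let $M_1,\dots,M_d$ have any non-empty finite alphabets, not all of cardinality one, let $B_1,\dots,B_d$ be their sizes in bits, $\bar B_k=B_k/\sum_jB_j$, and $$P=(P_\alpha,P_\beta)=\Big(d\sum_{k=1}^dT_{d,k}\bar B_k,\ \sum_{k=1}^dT_{d,k}\bar B_k\Big).$$ Then: 1. Separate coding achieves $P$: for some $s\ge 1$ there are, for blocks of $s$ messages (of $sB_k$ bits, which leaves the $\bar B_k$ unchanged), $(n,k,d)$ exact-repair regenerating codes for $k=1,\dots,d$ with exactly $\alpha_k=d\,T_{d,k}\,sB_k$ and $\beta_k=T_{d,k}\,sB_k$, which are MBR codes whenever $B_k>0$, such that the MLDR code obtained from them by separate coding achieves $P$ for $(\bar B_1,\dots,\bar B_d)$. 2. For every $k\in\{1,\dots,d\}$ the MBR point of the $(n,k,d)$ exact-repair problem is $(d\,T_{d,k},T_{d,k})$.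 3. Every pair $(\bar\alpha,\bar\beta)$ that is achievable for $(\bar B_1,\dots,\bar B_d)$ satisfies $$\bar\beta\ge\sum_{k=1}^dT_{d,k}\bar B_k\quad\text{and}\quad \bar\alpha+J_{d-1}\bar\beta\ge J_d\sum_{k=1}^dT_{d,k}\bar B_k .$$ 4. $P$ is the unique point at which both of these bounds hold with equality. 5. $P$ is the MBR point of the MLDR problem with normalized message sizes $(\bar B_1,\dots,\bar B_d)$. In particular, separate coding achieves the MBR point for every MLDR problem. -/

import Mathlib

namespace MLDR

/-- The size of a finite alphabet, in bits: the base-two logarithm of its cardinality. -/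
noncomputable def bits (A : Type) : ℝ := Real.logb 2 (Nat.card A)

/-- `T_{d,k} = 1 / ∑_{i=1}^k (d + 1 - i)`. -/
noncomputable def T (d k : ℕ) : ℝ := 1 / ∑ i ∈ Finset.Icc 1 k, ((d : ℝ) + 1 - (i : ℝ))

/-- `J_d = ∑_{i=1}^d i`. -/
noncomputable def J (d : ℕ) : ℝ := ∑ i ∈ Finset.Icc 1 d, (i : ℝ)

/-- An `(n,k,d)` exact-repair regenerating code storing one message from `M` in `n` nodes, each
holding a symbol of `W`, where every helper node sends a symbol of `S`. The data sent by helper `j`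
is a function of the content of node `j`; the function may depend on the failed node `i` and
on the set `A` of helpers. The values of `dec` and `repair` at sets `A` of other sizes
are irrelevant. -/
structure RegeneratingCode (n k d : ℕ) (M W S : Type) where
  enc : Fin n → M → W
  dec : (A : Finset (Fin n)) → (A → W) → M
  help : (i : Fin n) → (A : Finset (Fin n)) → A → W → S
  repair : (i : Fin n) → (A : Finset (Fin n)) → (A → S) → W
  reconstruction : ∀ A : Finset (Fin n), A.card = k →
    ∀ m : M, dec A (fun j => enc j m) = m
  regeneration : ∀ (i : Fin n) (A : Finset (Fin n)), A.card = d → i ∉ A →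
    ∀ m : M, repair i A (fun j => help i A j (enc j m)) = enc i m

/-- An `(n,d)` code for multilevel diversity coding with regeneration. The message `M_{k+1}` of
the usual one-based numbering has alphabet `M k`, `k : Fin d`, and is recovered from any
`k + 1` nodes. The requirements hold for every tuple of messages (independent messages,
zero error). -/
structure MLDRCode (n d : ℕ) (M : Fin d → Type) (W S : Type) where
  enc : Fin n → (∀ k, M k) → W
  dec : (k : Fin d) → (A : Finset (Fin n)) → (A → W) → M k
  help : (i : Fin n) → (A : Finset (Fin n)) → A → W → S
  repair : (i : Fin n) → (A : Finset (Fin n)) → (A → S) → W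
  reconstruction : ∀ (k : Fin d) (A : Finset (Fin n)), A.card = (k : ℕ) + 1 →
    ∀ m : (∀ k, M k), dec k A (fun j => enc j m) = m k
  regeneration : ∀ (i : Fin n) (A : Finset (Fin n)), A.card = d → i ∉ A →
    ∀ m : (∀ k, M k), repair i A (fun j => help i A j (enc j m)) = enc i m

/-- Separate coding: the message with index `k` is encoded by its own regenerating code `C k`;
node contents and helper data are the tuples of those of the individual codes. -/
def separateCode {n d : ℕ} {M W S : Fin d → Type}
    (C : ∀ k : Fin d, RegeneratingCode n ((k : ℕ) + 1) d (M k) (W k) (S k)) :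
    MLDRCode n d M (∀ k, W k) (∀ k, S k) where
  enc i m := fun k => (C k).enc i (m k)
  dec k A w := (C k).dec A (fun j => w j k)
  help i A j w := fun k => (C k).help i A j (w k)
  repair i A s := fun k => (C k).repair i A (fun j => s j k)
  reconstruction k A hA m := (C k).reconstruction A hA (m k)
  regeneration i A hA hi m := funext fun k => (C k).regeneration i A hA hi (m k)

/-- The message sizes `B_k`, normalized by their sum. -/
noncomputable def normalizedSizes {d : ℕ} (M : Fin d → Type) (k : Fin d) : ℝ :=
  bits (M k) / ∑ j, bits (M j)

/-- The regenerating code `C` achieves the normalized pair `(p.1, p.2)`: it is a code for a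
message of `B > 0` bits, and its node contents and helper data fit into
`α = p.1 * B` and `β = p.2 * B` bits. -/
def RegeneratingCode.Achieves {n k d : ℕ} {M W S : Type}
    (_C : RegeneratingCode n k d M W S) (p : ℝ × ℝ) : Prop :=
  Finite M ∧ Finite W ∧ Finite S ∧ 0 < bits M ∧
    bits W ≤ p.1 * bits M ∧ bits S ≤ p.2 * bits M

/-- The MLDR code `C` achieves the normalized pair `(p.1, p.2)` for the normalized message size
tuple `Bbar`. -/
def MLDRCode.Achieves {n d : ℕ} {M : Fin d → Type} {W S : Type}
    (_C : MLDRCode n d M W S) (Bbar : Fin d → ℝ) (p : ℝ × ℝ) : Prop :=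
  (∀ k, Finite (M k) ∧ Nonempty (M k)) ∧ Finite W ∧ Finite S ∧ 0 < ∑ k, bits (M k) ∧
    (∀ k, Bbar k = normalizedSizes M k) ∧
    bits W ≤ p.1 * ∑ k, bits (M k) ∧ bits S ≤ p.2 * ∑ k, bits (M k)

/-- The achievable pairs `(ᾱ, β̄)` of the `(n,k,d)` exact-repair problem. -/
def regeneratingRegion (n k d : ℕ) : Set (ℝ × ℝ) :=
  {p | ∃ (M W S : Type) (C : RegeneratingCode n k d M W S), C.Achieves p}

/-- The achievable pairs `(ᾱ, β̄)` of the `(n,d)` MLDR problem with normalized message sizes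
`Bbar`. -/
def mldrRegion (n d : ℕ) (Bbar : Fin d → ℝ) : Set (ℝ × ℝ) :=
  {p | ∃ (M : Fin d → Type) (W S : Type) (C : MLDRCode n d M W S), C.Achieves Bbar p}

/-- `p` is the minimum-bandwidth-regenerating point of a region of pairs `(ᾱ, β̄)`: it is in the
region, it has the least `β̄`, and the least `ᾱ` among the pairs with that `β̄`. -/
def IsMBRPoint (R : Set (ℝ × ℝ)) (p : ℝ × ℝ) : Prop :=
  p ∈ R ∧ ∀ q ∈ R, p.2 ≤ q.2 ∧ (q.2 = p.2 → p.1 ≤ q.1)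

/-- `C` is an MBR code: its own normalized pair is the MBR point of the exact-repair problem. -/
def RegeneratingCode.IsMBR {n k d : ℕ} {M W S : Type}
    (C : RegeneratingCode n k d M W S) : Prop :=
  C.Achieves (bits W / bits M, bits S / bits M) ∧
    IsMBRPoint (regeneratingRegion n k d) (bits W / bits M, bits S / bits M)

/-- `∑_{k=1}^d T_{d,k} B̄_k`. -/
noncomputable def weightedSize {d : ℕ} (Bbar : Fin d → ℝ) : ℝ :=
  ∑ k : Fin d, T d ((k : ℕ) + 1) * Bbar k

end MLDR

/-!
By symmetry, entropies may be averaged over all orders of `d + 1` of the nodes. Two inequalities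
drive the converse. The data that a node receives determines its content, so the entropy increment
of the data received by one more node is at most that of the data received by its predecessor, given
moreover the content of a further node. And a conditional form of Han's inequality bounds the latter
increment by a fraction of the unconditional one, because the content of a node determines all that
it sends. Together they make `T d k` times the entropy of the data received by `k` nodes, given the
first messages, nonincreasing in `k`. Each time that `k` nodes recover one more message, its entropy
is split off with the weight `T d k`, which gives the bound on `β`; following the content of the
further node gives the bound on `α + J (d - 1) * β`. As `J d = J (d - 1) + d`, both bounds are
tight only at `P`.

For `P` itself, the message of a product-matrix code is a symmetric `d × d` matrix with
`1 / T d k` free entries in a commutative ring, and the nodes store its products with Vandermonde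
vectors. The code only needs points of the ring whose differences are units, so that products of
finite fields provide rings of every cardinality `q ^ t` with `n ≤ t`, and hence codes for blocks of
messages from any alphabet, without rounding. Separate coding adds up the sizes of these codes.
-/

namespace MLDR

open Finset
open scoped BigOperators

section Entropy

variable {Ω : Type*} [Fintype Ω]

open Classical in
/-- The number of elements of the class of `ω`. It is real-valued because it only occurs in
quotients. -/
noncomputable def classSize (s : Setoid Ω) (ω : Ω) : ℝ := (#{x | s ω x} : ℕ)

lemma classSize_pos (s : Setoid Ω) (ω : Ω) : 0 < classSize s ω := by
  classical
  exact Nat.cast_pos.mpr (card_pos.mpr ⟨ω, mem_filter.mpr ⟨mem_univ ω, s.refl ω⟩⟩)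

lemma classSize_congr (s : Setoid Ω) {x y : Ω} (h : s x y) : classSize s x = classSize s y := by
  classical
  exact congrArg (fun A : Finset Ω => (#A : ℝ))
    (filter_congr fun _ _ => ⟨s.trans (s.symm h), s.trans h⟩)

lemma classSize_mono {s t : Setoid Ω} (h : s ≤ t) (ω : Ω) : classSize s ω ≤ classSize t ω := by
  classical
  exact Nat.cast_le.mpr (card_le_card (monotone_filter_right _ fun _ _ hx => h hx))

lemma sum_inv_classSize_le_one (s : Setoid Ω) {A : Finset Ω} (hA : ∀ x ∈ A, ∀ y ∈ A, s x y) :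
    ∑ x ∈ A, (classSize s x)⁻¹ ≤ 1 := by
  classical
  obtain rfl | ⟨ω, hω⟩ := A.eq_empty_or_nonempty
  · simp
  have hcard : (#A : ℝ) ≤ classSize s ω :=
    Nat.cast_le.mpr (card_le_card fun x hx => mem_filter.mpr ⟨mem_univ x, hA ω hω x hx⟩)
  rw [sum_congr rfl fun x hx => congrArg (·⁻¹) (classSize_congr s (hA x hx ω hω)), sum_const,
    nsmul_eq_mul]
  exact mul_inv_le_one_of_le₀ hcard (classSize_pos s ω).le

/-- The entropy, in bits, of a partition of a finite set whose elements are equally likely. Random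
variables enter as the partitions into their fibers, given as setoids: then `s ⊓ t` stands for the
pair of `s` and `t`, and `s ≤ t` says that `t` is a function of `s`. -/
noncomputable def entropy (s : Setoid Ω) : ℝ :=
  𝔼 ω, Real.logb 2 (Fintype.card Ω / classSize s ω)

lemma card_div_classSize_pos (s : Setoid Ω) (ω : Ω) : 0 < Fintype.card Ω / classSize s ω :=
  div_pos (Nat.cast_pos.mpr (Fintype.card_pos_iff.mpr ⟨ω⟩)) (classSize_pos s ω)

lemma entropy_anti : Antitone (entropy : Setoid Ω → ℝ) := fun s t h =>
  expect_le_expect fun ω _ => Real.logb_le_logb_of_le one_lt_two (card_div_classSize_pos t ω)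
    (div_le_div_of_nonneg_left (Nat.cast_nonneg _) (classSize_pos s ω) (classSize_mono h ω))

lemma entropy_top : entropy (⊤ : Setoid Ω) = 0 := by
  refine expect_eq_zero fun ω _ => ?_
  have hclass : classSize ⊤ ω = Fintype.card Ω :=
    congrArg Nat.cast (congrArg card (filter_true univ))
  rw [← hclass, div_self (classSize_pos ⊤ ω).ne', Real.logb_one]

lemma expect_logb_le_logb_expect {ι : Type*} [Fintype ι] [Nonempty ι] {b : ℝ} (hb : 1 < b)
    {f : ι → ℝ} (hf : ∀ i, 0 < f i) : 𝔼 i, Real.logb b (f i) ≤ Real.logb b (𝔼 i, f i) := by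
  have hcard : (0 : ℝ) < Fintype.card ι := Nat.cast_pos.mpr Fintype.card_pos
  have jensen := strictConcaveOn_log_Ioi.concaveOn.le_map_sum (t := univ) (p := f)
    (w := fun _ => (Fintype.card ι : ℝ)⁻¹) (fun _ _ => inv_nonneg.mpr hcard.le)
    (by simp [hcard.ne']) fun i _ => hf i
  simp only [smul_eq_mul, inv_mul_eq_div, ← sum_div, ← Fintype.expect_eq_sum_div_card] at jensen
  simp only [Real.logb, ← expect_div]
  exact div_le_div_of_nonneg_right jensen (Real.log_pos hb).le

lemma bits_nonneg (A : Type) : 0 ≤ bits A := by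
  rw [bits, Real.logb]
  exact div_nonneg (Real.log_natCast_nonneg _) (Real.log_nonneg one_le_two)

lemma entropy_ker_le_bits {A : Type} [Finite A] (f : Ω → A) :
    entropy (Setoid.ker f) ≤ bits A := by
  classical
  obtain hΩ | hΩ := isEmpty_or_nonempty Ω
  · simpa [entropy] using bits_nonneg A
  have := Fintype.ofFinite A
  have fiber_sum_le (a : A) : ∑ ω with f ω = a, (classSize (Setoid.ker f) ω)⁻¹ ≤ 1 :=
    sum_inv_classSize_le_one _ fun x hx y hy =>
      (mem_filter.mp hx).2.trans (mem_filter.mp hy).2.symm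
  have expect_le_card : 𝔼 ω, Fintype.card Ω / classSize (Setoid.ker f) ω ≤ Nat.card A := by
    simp only [div_eq_mul_inv]
    rw [← mul_expect, Fintype.expect_eq_sum_div_card,
      mul_div_cancel₀ _ (Nat.cast_ne_zero.mpr Fintype.card_ne_zero),
      ← sum_fiberwise univ f, Nat.card_eq_fintype_card]
    simpa using sum_le_sum fun a (_ : a ∈ univ) => fiber_sum_le a
  exact (expect_logb_le_logb_expect one_lt_two (card_div_classSize_pos _)).trans
    (Real.logb_le_logb_of_le one_lt_two (expect_pos (fun ω _ => card_div_classSize_pos _ ω)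
      univ_nonempty) expect_le_card)

/-- The summand is the ratio of the product of the laws of `s` and `t` given `u` to their joint law
given `u`, so that the sum counts the pairs `(x, y)` in a class of `u` with weight at most
`1 / classSize u x`. -/
lemma sum_classSize_mul_div_le {s t u : Setoid Ω} (hs : s ≤ u) (ht : t ≤ u) :
    ∑ ω, classSize s ω * classSize t ω / (classSize (s ⊓ t) ω * classSize u ω) ≤
      Fintype.card Ω := by
  classical
  calc ∑ ω, classSize s ω * classSize t ω / (classSize (s ⊓ t) ω * classSize u ω)
      = ∑ ω, ∑ x with s ω x, ∑ y with t ω y, (classSize u x)⁻¹ * (classSize (s ⊓ t) ω)⁻¹ := by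
        refine sum_congr rfl fun ω _ => ?_
        rw [sum_congr rfl fun x hx => by
          rw [← classSize_congr u (hs (mem_filter.mp hx).2)]]
        simp only [sum_const, nsmul_eq_mul]
        rw [div_eq_mul_inv, mul_inv_rev, mul_assoc]
        rfl
    _ = ∑ x, ∑ ω with s ω x, ∑ y with t ω y, (classSize u x)⁻¹ * (classSize (s ⊓ t) ω)⁻¹ :=
        sum_comm' (by simp)
    _ = ∑ x, ∑ y with u x y, ∑ ω with s ω x ∧ t ω y,
          (classSize u x)⁻¹ * (classSize (s ⊓ t) ω)⁻¹ := by
        refine sum_congr rfl fun x _ => sum_comm' fun ω y => ?_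
        simp only [mem_filter, mem_univ, true_and]
        exact ⟨fun h => ⟨h, u.trans (u.symm (hs h.1)) (ht h.2)⟩, And.left⟩
    _ ≤ ∑ x, ∑ y with u x y, (classSize u x)⁻¹ := by
        gcongr with x _ y _
        rw [← mul_sum]
        refine mul_le_of_le_one_right (inv_nonneg.mpr (classSize_pos u x).le)
          (sum_inv_classSize_le_one _ fun ω hω ω' hω' => ?_)
        obtain ⟨hx, hy⟩ := (mem_filter.mp hω).2
        obtain ⟨hx', hy'⟩ := (mem_filter.mp hω').2
        exact ⟨s.trans hx (s.symm hx'), t.trans hy (t.symm hy')⟩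
    _ = Fintype.card Ω := by
        have sum_eq_one (x : Ω) : ∑ y with u x y, (classSize u x)⁻¹ = 1 := by
          rw [sum_const, nsmul_eq_mul]
          exact mul_inv_cancel₀ (classSize_pos u x).ne'
        simp [sum_eq_one]

theorem entropy_submodular {s t u : Setoid Ω} (hs : s ≤ u) (ht : t ≤ u) :
    entropy (s ⊓ t) + entropy u ≤ entropy s + entropy t := by
  obtain hΩ | hΩ := isEmpty_or_nonempty Ω
  · simp [entropy]
  have hcard : (Fintype.card Ω : ℝ) ≠ 0 := Nat.cast_ne_zero.mpr Fintype.card_ne_zero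
  set r : Ω → ℝ := fun ω =>
    classSize s ω * classSize t ω / (classSize (s ⊓ t) ω * classSize u ω)
  have hr (ω : Ω) : 0 < r ω := div_pos (mul_pos (classSize_pos s ω) (classSize_pos t ω))
    (mul_pos (classSize_pos _ ω) (classSize_pos u ω))
  have logb_ratio (ω : Ω) : Real.logb 2 (r ω) =
      (Real.logb 2 (Fintype.card Ω / classSize (s ⊓ t) ω) +
        Real.logb 2 (Fintype.card Ω / classSize u ω)) -
      (Real.logb 2 (Fintype.card Ω / classSize s ω) +
        Real.logb 2 (Fintype.card Ω / classSize t ω)) := by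
    simp only [r, Real.logb_div, Real.logb_mul, hcard, (classSize_pos _ ω).ne', mul_eq_zero,
      ne_eq, not_false_eq_true, or_self]
    ring
  have expect_logb_nonpos : 𝔼 ω, Real.logb 2 (r ω) ≤ 0 := by
    refine (expect_logb_le_logb_expect one_lt_two hr).trans
      (Real.logb_nonpos one_lt_two (expect_nonneg fun ω _ => (hr ω).le) ?_)
    rw [Fintype.expect_eq_sum_div_card]
    exact div_le_one_of_le₀ (sum_classSize_mul_div_le hs ht) (Nat.cast_nonneg _)
  simpa only [entropy, logb_ratio, expect_sub_distrib, expect_add_distrib, sub_nonpos] using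
    expect_logb_nonpos

/-- The conditional entropy `H(X | c)`. -/
noncomputable def condEntropy (X c : Setoid Ω) : ℝ := entropy (X ⊓ c) - entropy c

lemma condEntropy_mono_right (X : Setoid Ω) : Monotone (condEntropy X) := fun c c' h => by
  have key := entropy_submodular (inf_le_right : X ⊓ c' ≤ c') h
  rw [inf_assoc, inf_eq_right.mpr h] at key
  simp only [condEntropy]
  linarith

lemma condEntropy_inf_left (X Y c : Setoid Ω) :
    condEntropy (X ⊓ Y) c = condEntropy X (Y ⊓ c) + condEntropy Y c := by
  simp only [condEntropy, inf_assoc, sub_add_sub_cancel]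

lemma condEntropy_biInf_le_sum {ι : Type*} (f : ι → Setoid Ω) (c : Setoid Ω) (A : Finset ι) :
    condEntropy (⨅ i ∈ A, f i) c ≤ ∑ i ∈ A, condEntropy (f i) c := by
  classical
  induction A using Finset.induction_on with
  | empty => simp [condEntropy]
  | insert i A hi ih =>
    rw [Finset.iInf_insert, condEntropy_inf_left, sum_insert hi]
    exact add_le_add (condEntropy_mono_right _ inf_le_right) ih

end Entropy

section Repair

variable {Ω : Type*} {V : Type*}

/-- All the data that node `i` receives during its repair, when helper `j` sends `S j i`. -/
def incoming (S : V → V → Setoid Ω) (i : V) : Setoid Ω := ⨅ j, ⨅ _ : j ≠ i, S j i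

lemma incoming_le_help (S : V → V → Setoid Ω) {i j : V} (hij : j ≠ i) : incoming S i ≤ S j i :=
  iInf₂_le j hij

/-- The node contents `W` are repaired exactly from the helper data `S`: node `j` computes the data
`S j i` for the repair of `i` from its content, and `i` recovers its content from what it
receives. The values `S i i` play no role. -/
structure IsExactRepair (W : V → Setoid Ω) (S : V → V → Setoid Ω) : Prop where
  content_le_help : ∀ {i j : V}, j ≠ i → W j ≤ S j i
  incoming_le_content : ∀ i, incoming S i ≤ W i

variable [Fintype Ω]

lemma condEntropy_incoming_le {S : V → V → Setoid Ω} {i j : V} (hij : j ≠ i) {X : Setoid Ω}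
    (hX : X ≤ S j i) (c : Setoid Ω) :
    condEntropy (incoming S i) (X ⊓ c) ≤
      condEntropy (incoming S i) c - condEntropy (S j i) c := by
  have chain := condEntropy_inf_left (incoming S i) (S j i) c
  rw [inf_eq_left.mpr (incoming_le_help S hij)] at chain
  have := condEntropy_mono_right (incoming S i) (inf_le_inf_right c hX)
  linarith

lemma condEntropy_incoming_le_sum (S : V → V → Setoid Ω) (i : V) (A : Finset V) {c : Setoid Ω}
    (hc : ∀ j ∉ A, j ≠ i → c ≤ S j i) :
    condEntropy (incoming S i) c ≤ ∑ j ∈ A, condEntropy (S j i) c := by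
  refine le_trans (sub_le_sub_right (entropy_anti ?_) _) (condEntropy_biInf_le_sum _ c A)
  refine le_inf (le_iInf₂ fun j hj => ?_) inf_le_right
  by_cases hjA : j ∈ A
  · exact inf_le_left.trans (iInf₂_le j hjA)
  · exact inf_le_right.trans (hc j hjA hj)

/-- A conditional form of Han's inequality. -/
lemma sum_condEntropy_incoming_le {S : V → V → Setoid Ω} {W : V → Setoid Ω} {i : V} {A : Finset V}
    (hi : i ∉ A) (hW : ∀ j ∈ A, W j ≤ S j i) {c : Setoid Ω} (hc : ∀ j ∉ A, j ≠ i → c ≤ S j i) :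
    ∑ j ∈ A, condEntropy (incoming S i) (W j ⊓ c) ≤
      ((#A : ℝ) - 1) * condEntropy (incoming S i) c := by
  have each := sum_le_sum fun j (hj : j ∈ A) =>
    condEntropy_incoming_le (ne_of_mem_of_not_mem hj hi) (hW j hj) c
  rw [sum_sub_distrib, sum_const, nsmul_eq_mul] at each
  linarith [condEntropy_incoming_le_sum S i A hc]

end Repair

section MeanEntropy

variable {Ω : Type*} {d : ℕ}

/-- The data received by the nodes in the first `k` positions of the order `π`. -/
def incomingFirst (S : Fin (d + 1) → Fin (d + 1) → Setoid Ω) (π : Equiv.Perm (Fin (d + 1)))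
    (k : ℕ) : Setoid Ω :=
  ⨅ p : Fin (d + 1), ⨅ _ : (p : ℕ) < k, incoming S (π p)

variable {S : Fin (d + 1) → Fin (d + 1) → Setoid Ω} {W : Fin (d + 1) → Setoid Ω}
  {π : Equiv.Perm (Fin (d + 1))} {k : ℕ}

lemma incomingFirst_le_incoming {p : Fin (d + 1)} (hp : (p : ℕ) < k) :
    incomingFirst S π k ≤ incoming S (π p) :=
  iInf₂_le p hp

lemma incomingFirst_zero : incomingFirst S π 0 = ⊤ := by
  simp [incomingFirst]

lemma incomingFirst_succ (q : Fin (d + 1)) :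
    incomingFirst S π (q + 1) = incoming S (π q) ⊓ incomingFirst S π q := by
  refine le_antisymm (le_inf (incomingFirst_le_incoming (Nat.lt_succ_self q))
    (le_iInf₂ fun p hp => incomingFirst_le_incoming (hp.trans (Nat.lt_succ_self q))))
    (le_iInf₂ fun p hp => ?_)
  obtain hpq | hpq := Nat.lt_succ_iff_lt_or_eq.mp hp
  · exact inf_le_right.trans (incomingFirst_le_incoming hpq)
  · exact inf_le_left.trans_eq (by rw [Fin.ext hpq])

lemma incomingFirst_mul_swap {p q : Fin (d + 1)} (hp : k ≤ p) (hq : k ≤ q) :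
    incomingFirst S (π * Equiv.swap p q) k = incomingFirst S π k := by
  refine iInf_congr fun r => iInf_congr fun hr => ?_
  rw [Equiv.Perm.mul_apply, Equiv.swap_apply_of_ne_of_ne] <;> rintro rfl <;> omega

lemma expect_perm_mul_swap (p q : Fin (d + 1)) (f : Equiv.Perm (Fin (d + 1)) → ℝ) :
    𝔼 π, f (π * Equiv.swap p q) = 𝔼 π, f π :=
  Fintype.expect_equiv (Equiv.mulRight (Equiv.swap p q)) _ _ fun _ => rfl

variable [Fintype Ω]

/-- The average, over the orders `π` of the nodes, of the joint entropy of `X` at the last node and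
of the data received by the first `k` nodes. -/
noncomputable def meanEntropy (S : Fin (d + 1) → Fin (d + 1) → Setoid Ω)
    (X : Fin (d + 1) → Setoid Ω) (k : ℕ) : ℝ :=
  𝔼 π : Equiv.Perm (Fin (d + 1)), entropy (X (π (Fin.last d)) ⊓ incomingFirst S π k)

lemma meanEntropy_congr {X Y : Fin (d + 1) → Setoid Ω}
    (h : ∀ π : Equiv.Perm (Fin (d + 1)), X (π (Fin.last d)) ⊓ incomingFirst S π k =
      Y (π (Fin.last d)) ⊓ incomingFirst S π k) :
    meanEntropy S X k = meanEntropy S Y k :=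
  expect_congr rfl fun π _ => congrArg entropy (h π)

lemma le_meanEntropy {X : Fin (d + 1) → Setoid Ω} {a : ℝ}
    (h : ∀ π : Equiv.Perm (Fin (d + 1)),
      a ≤ entropy (X (π (Fin.last d)) ⊓ incomingFirst S π k)) :
    a ≤ meanEntropy S X k :=
  le_expect univ_nonempty fun π _ => h π

lemma meanEntropy_const_zero (K : Setoid Ω) : meanEntropy S (fun _ => K) 0 = entropy K := by
  simp [meanEntropy, incomingFirst_zero]

lemma meanEntropy_zero_le {X : Fin (d + 1) → Setoid Ω} {a : ℝ} (h : ∀ i, entropy (X i) ≤ a) :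
    meanEntropy S X 0 ≤ a :=
  expect_le univ_nonempty fun π _ => by
    rw [incomingFirst_zero, inf_top_eq]
    exact h _

lemma meanEntropy_const_succ (K : Setoid Ω) (q : Fin (d + 1)) :
    meanEntropy S (fun _ => K) (q + 1) = meanEntropy S (fun i => K ⊓ incoming S i) q := by
  rw [meanEntropy, ← expect_perm_mul_swap q (Fin.last d)]
  refine expect_congr rfl fun π _ => ?_
  rw [incomingFirst_succ, incomingFirst_mul_swap le_rfl (Fin.le_last q), Equiv.Perm.mul_apply,
    Equiv.swap_apply_left, inf_assoc]

lemma meanEntropy_succ_sub (X : Fin (d + 1) → Setoid Ω) (q : Fin (d + 1)) :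
    meanEntropy S X (q + 1) - meanEntropy S X q =
      𝔼 π : Equiv.Perm (Fin (d + 1)),
        condEntropy (incoming S (π q)) (X (π (Fin.last d)) ⊓ incomingFirst S π q) := by
  simp only [meanEntropy, ← expect_sub_distrib, condEntropy, incomingFirst_succ, inf_left_comm]

lemma meanEntropy_succ_sub_mono {X Y : Fin (d + 1) → Setoid Ω} (h : X ≤ Y) (q : Fin (d + 1)) :
    meanEntropy S X (q + 1) - meanEntropy S X q ≤
      meanEntropy S Y (q + 1) - meanEntropy S Y q := by
  simp only [meanEntropy_succ_sub]
  exact expect_le_expect fun π _ => condEntropy_mono_right _ (inf_le_inf_right _ (h _))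

lemma meanEntropy_const_succ_sub_le (hWS : IsExactRepair W S) (K : Setoid Ω) (hk : k < d) :
    meanEntropy S (fun _ => K) (k + 2) - meanEntropy S (fun _ => K) (k + 1) ≤
      meanEntropy S (fun i => K ⊓ W i) (k + 1) - meanEntropy S (fun i => K ⊓ W i) k := by
  rw [meanEntropy_const_succ K ⟨k + 1, by omega⟩, meanEntropy_const_succ K ⟨k, by omega⟩]
  exact meanEntropy_succ_sub_mono (fun i => inf_le_inf_left K (hWS.incoming_le_content i))
    ⟨k, by omega⟩

lemma sum_Ioi_condEntropy_incoming_le (hWS : IsExactRepair W S) (K : Setoid Ω)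
    (π : Equiv.Perm (Fin (d + 1))) (q : Fin (d + 1)) :
    ∑ p ∈ Ioi q, condEntropy (incoming S (π q)) (K ⊓ W (π p) ⊓ incomingFirst S π q) ≤
      ((d : ℝ) - q - 1) * condEntropy (incoming S (π q)) (K ⊓ incomingFirst S π q) := by
  have known : ∀ j ∉ (Ioi q).map π.toEmbedding, j ≠ π q →
      K ⊓ incomingFirst S π q ≤ S j (π q) := by
    intro j hj hjq
    obtain ⟨p, rfl⟩ := π.surjective j
    have hpq : p < q := lt_of_le_of_ne (by simpa using hj) (ne_of_apply_ne π hjq)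
    exact inf_le_right.trans ((incomingFirst_le_incoming hpq).trans
      ((hWS.incoming_le_content _).trans (hWS.content_le_help hjq)))
  have han := sum_condEntropy_incoming_le (S := S) (W := W) (by simp)
    (fun j hj => hWS.content_le_help (by rintro rfl; simp at hj)) known
  rw [sum_map, card_map, Fin.card_Ioi, show d + 1 - 1 - (q : ℕ) = d - q from rfl,
    Nat.cast_sub q.is_le] at han
  simpa only [inf_assoc, inf_left_comm (W _), Equiv.coe_toEmbedding] using han

lemma mul_meanEntropy_content_succ_sub_le (hWS : IsExactRepair W S) (K : Setoid Ω) (hk : k < d) :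
    ((d : ℝ) - k) *
        (meanEntropy S (fun i => K ⊓ W i) (k + 1) - meanEntropy S (fun i => K ⊓ W i) k) ≤
      ((d : ℝ) - k - 1) *
        (meanEntropy S (fun _ => K) (k + 1) - meanEntropy S (fun _ => K) k) := by
  obtain ⟨q, rfl⟩ : ∃ q : Fin (d + 1), (q : ℕ) = k := ⟨⟨k, by omega⟩, rfl⟩
  simp only [meanEntropy_succ_sub]
  have expect_swap (p : Fin (d + 1)) (hp : p ∈ Ioi q) :
      𝔼 π : Equiv.Perm (Fin (d + 1)), condEntropy (incoming S (π q))
          (K ⊓ W (π p) ⊓ incomingFirst S π q) =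
        𝔼 π : Equiv.Perm (Fin (d + 1)), condEntropy (incoming S (π q))
          (K ⊓ W (π (Fin.last d)) ⊓ incomingFirst S π q) := by
    rw [mem_Ioi] at hp
    rw [← expect_perm_mul_swap p (Fin.last d)]
    refine expect_congr rfl fun π _ => ?_
    rw [incomingFirst_mul_swap hp.le (Fin.le_last q), Equiv.Perm.mul_apply, Equiv.Perm.mul_apply,
      Equiv.swap_apply_left, Equiv.swap_apply_of_ne_of_ne hp.ne (by rintro rfl; exact hk.ne rfl)]
  calc _ = ∑ p ∈ Ioi q, 𝔼 π : Equiv.Perm (Fin (d + 1)), condEntropy (incoming S (π q))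
          (K ⊓ W (π p) ⊓ incomingFirst S π q) := by
        rw [sum_congr rfl expect_swap, sum_const, Fin.card_Ioi, nsmul_eq_mul,
          Nat.add_sub_cancel, Nat.cast_sub q.is_le]
    _ = 𝔼 π : Equiv.Perm (Fin (d + 1)), ∑ p ∈ Ioi q, condEntropy (incoming S (π q))
          (K ⊓ W (π p) ⊓ incomingFirst S π q) := (expect_sum_comm ..).symm
    _ ≤ _ := by
        rw [mul_expect]
        exact expect_le_expect fun π _ => sum_Ioi_condEntropy_incoming_le hWS K π q

end MeanEntropy

section RepairCount

variable {d k : ℕ}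

/-- The denominator of `T d k`, for `k ≤ d`, as a natural number: the number of helper transmissions
that are new when `k` nodes are repaired one after the other, and the number of symbols in a message
of the product-matrix code. -/
def repairCount (d k : ℕ) : ℕ := ∑ i ∈ range k, (d - i)

lemma cast_repairCount_succ (hk : k ≤ d) :
    (repairCount d (k + 1) : ℝ) = repairCount d k + (d - k) := by
  rw [repairCount, sum_range_succ, Nat.cast_add, Nat.cast_sub hk, repairCount]

lemma repairCount_one (d : ℕ) : repairCount d 1 = d := by
  simp [repairCount]

lemma repairCount_succ_pos (hk : k < d) : 0 < repairCount d (k + 1) := by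
  rw [repairCount, sum_range_succ']
  omega

lemma T_eq_inv_repairCount (hk : k ≤ d) : T d k = (repairCount d k : ℝ)⁻¹ := by
  rw [T, one_div, repairCount, Nat.cast_sum, ← Ico_add_one_right_eq_Icc, sum_Ico_eq_sum_range,
    Nat.add_sub_cancel]
  congr 1
  refine sum_congr rfl fun i hi => ?_
  rw [Nat.cast_sub ((mem_range.mp hi).le.trans hk)]
  push_cast
  ring

lemma repairCount_mul_T (hk : k < d) : (repairCount d (k + 1) : ℝ) * T d (k + 1) = 1 := by
  rw [T_eq_inv_repairCount hk]
  exact mul_inv_cancel₀ (Nat.cast_ne_zero.mpr (repairCount_succ_pos hk).ne')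

lemma T_succ_nonneg (hk : k < d) : 0 ≤ T d (k + 1) := by
  rw [T_eq_inv_repairCount hk]
  positivity

lemma J_eq_repairCount (d : ℕ) : J d = repairCount d d := by
  rw [J, ← Nat.cast_sum, repairCount, ← Ico_add_one_right_eq_Icc, sum_Ico_eq_sum_range,
    Nat.add_sub_cancel, ← sum_range_reflect (1 + ·)]
  exact congrArg _ (sum_congr rfl fun i hi => by have := mem_range.mp hi; omega)

lemma J_pred (d : ℕ) : J (d - 1) = J d - d := by
  cases d with
  | zero => simp
  | succ m => simp [J, sum_Icc_succ_top]

lemma J_nonneg (d : ℕ) : 0 ≤ J d := by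
  rw [J_eq_repairCount]
  positivity

end RepairCount

section HelpAndContent

-- `F j` stands for the mean joint entropy of some messages and of the data received by `j` nodes,
-- and `G j` for its value when the content of one further node is added.
variable {d j : ℕ} {F G : ℕ → ℝ}

lemma repairCount_mul_succ_sub_le
    (hFG : ∀ j < d, F (j + 2) - F (j + 1) ≤ G (j + 1) - G j)
    (hGF : ∀ j < d, ((d : ℝ) - j) * (G (j + 1) - G j) ≤ ((d : ℝ) - j - 1) * (F (j + 1) - F j))
    (hj : j < d) :
    repairCount d (j + 1) * (F (j + 1) - F j) ≤ ((d : ℝ) - j) * (F (j + 1) - F 0) := by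
  induction j with
  | zero => simp [repairCount_one]
  | succ j ih =>
    have hj' : j < d := Nat.lt_of_succ_lt hj
    have hdj : (0 : ℝ) < d - j := sub_pos.mpr (Nat.cast_lt.mpr hj')
    have hdj' : (0 : ℝ) ≤ d - j - 1 := by
      rw [sub_sub, sub_nonneg]
      exact_mod_cast hj.le
    have increment_le : ((d : ℝ) - j) * (F (j + 2) - F (j + 1)) ≤ (d - j - 1) * (F (j + 1) - F j) :=
      (mul_le_mul_of_nonneg_left (hFG j hj') hdj.le).trans (hGF j hj')
    have scaled : ((d : ℝ) - j) * (repairCount d (j + 1) * (F (j + 2) - F (j + 1))) ≤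
        (d - j) * ((d - j - 1) * (F (j + 1) - F 0)) :=
      calc ((d : ℝ) - j) * (repairCount d (j + 1) * (F (j + 2) - F (j + 1)))
          ≤ repairCount d (j + 1) * ((d - j - 1) * (F (j + 1) - F j)) := by
            rw [mul_left_comm]
            exact mul_le_mul_of_nonneg_left increment_le (Nat.cast_nonneg _)
        _ ≤ (d - j - 1) * ((d - j) * (F (j + 1) - F 0)) := by
            rw [mul_left_comm]
            exact mul_le_mul_of_nonneg_left (ih hj') hdj'
        _ = _ := mul_left_comm ..
    have := le_of_mul_le_mul_left scaled hdj
    rw [cast_repairCount_succ hj.le]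
    push_cast
    linarith

lemma content_succ_sub_le
    (hFG : ∀ j < d, F (j + 2) - F (j + 1) ≤ G (j + 1) - G j)
    (hGF : ∀ j < d, ((d : ℝ) - j) * (G (j + 1) - G j) ≤ ((d : ℝ) - j - 1) * (F (j + 1) - F j))
    (hj : j < d) :
    G (j + 1) - G j ≤ ((d : ℝ) - j - 1) * (T d (j + 1) * (F (j + 1) - F 0)) := by
  have hdj : (0 : ℝ) < d - j := sub_pos.mpr (Nat.cast_lt.mpr hj)
  have hdj' : (0 : ℝ) ≤ d - j - 1 := by
    rw [sub_sub, sub_nonneg]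
    exact_mod_cast hj
  have hN : (0 : ℝ) < repairCount d (j + 1) := Nat.cast_pos.mpr (repairCount_succ_pos hj)
  have sub_le : F (j + 1) - F j ≤ (d - j) * (T d (j + 1) * (F (j + 1) - F 0)) := by
    rw [T_eq_inv_repairCount hj, mul_left_comm, le_inv_mul_iff₀ hN]
    exact repairCount_mul_succ_sub_le hFG hGF hj
  refine le_of_mul_le_mul_left ((hGF j hj).trans ?_) hdj
  rw [mul_left_comm]
  exact mul_le_mul_of_nonneg_left sub_le hdj'

lemma T_mul_help_succ_le
    (hFG : ∀ j < d, F (j + 2) - F (j + 1) ≤ G (j + 1) - G j)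
    (hGF : ∀ j < d, ((d : ℝ) - j) * (G (j + 1) - G j) ≤ ((d : ℝ) - j - 1) * (F (j + 1) - F j))
    (hj : j + 1 < d) :
    T d (j + 2) * (F (j + 2) - F 0) ≤ T d (j + 1) * (F (j + 1) - F 0) := by
  have hj' : j < d := Nat.lt_of_succ_lt hj
  have hN : (0 : ℝ) < repairCount d (j + 1) := Nat.cast_pos.mpr (repairCount_succ_pos hj')
  have hN' : (0 : ℝ) < repairCount d (j + 2) := Nat.cast_pos.mpr (repairCount_succ_pos hj)
  have increment_le := (hFG j hj').trans (content_succ_sub_le hFG hGF hj')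
  rw [T_eq_inv_repairCount hj, inv_mul_le_iff₀ hN']
  set w := T d (j + 1) * (F (j + 1) - F 0)
  have hw : F (j + 1) - F 0 = repairCount d (j + 1) * w := by
    simp only [w, T_eq_inv_repairCount (Nat.succ_le_of_lt hj')]
    rw [mul_inv_cancel_left₀ hN.ne']
  rw [cast_repairCount_succ hj.le]
  push_cast
  linarith

end HelpAndContent

section OuterBounds

variable {Ω : Type*} {d k : ℕ} {W : Fin (d + 1) → Setoid Ω}
  {S : Fin (d + 1) → Fin (d + 1) → Setoid Ω}

/-- A `(d + 1, d)` code for multilevel diversity coding with regeneration, in terms of partitions: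
`K k` is given by the first `k` messages, `W` by the node contents and `S` by the helper data. -/
structure IsMultilevelRepair (K : ℕ → Setoid Ω) (W : Fin (d + 1) → Setoid Ω)
    (S : Fin (d + 1) → Fin (d + 1) → Setoid Ω) : Prop extends IsExactRepair W S where
  zero_eq_top : K 0 = ⊤
  antitone : Antitone K
  recovers : ∀ k < d, ∀ A : Finset (Fin (d + 1)), #A = k + 1 → ⨅ i ∈ A, W i ≤ K (k + 1)

lemma incomingFirst_le_iInf_content (hWS : IsExactRepair W S) (π : Equiv.Perm (Fin (d + 1)))
    (q : Fin (d + 1)) : incomingFirst S π q ≤ ⨅ i ∈ (Iio q).map π.toEmbedding, W i := by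
  refine le_iInf₂ fun i hi => ?_
  obtain ⟨p, hp, rfl⟩ := mem_map.mp hi
  exact (incomingFirst_le_incoming (Fin.lt_def.mp (mem_Iio.mp hp))).trans
    (hWS.incoming_le_content _)

variable {K : ℕ → Setoid Ω}

lemma IsMultilevelRepair.incomingFirst_le (h : IsMultilevelRepair K W S) (hk : k < d)
    (π : Equiv.Perm (Fin (d + 1))) : incomingFirst S π (k + 1) ≤ K (k + 1) :=
  (incomingFirst_le_iInf_content h.toIsExactRepair π ⟨k + 1, by omega⟩).trans
    (h.recovers k hk _ (by rw [card_map, Fin.card_Iio]))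

lemma IsMultilevelRepair.content_inf_incomingFirst_le (h : IsMultilevelRepair K W S) (hk : k < d)
    (π : Equiv.Perm (Fin (d + 1))) : W (π (Fin.last d)) ⊓ incomingFirst S π k ≤ K (k + 1) := by
  let q : Fin (d + 1) := ⟨k, by omega⟩
  have last_notMem : π (Fin.last d) ∉ (Iio q).map π.toEmbedding := by
    simp [Fin.le_last]
  refine le_trans ?_ (h.recovers k hk (insert (π (Fin.last d)) ((Iio q).map π.toEmbedding)) ?_)
  · rw [Finset.iInf_insert]
    exact inf_le_inf_left _ (incomingFirst_le_iInf_content h.toIsExactRepair π q)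
  · rw [card_insert_of_notMem last_notMem, card_map, Fin.card_Iio]

variable [Fintype Ω] {α β : ℝ}

/-- `∑_{i=1}^k T_{d,i} (H(K_i) - H(K_{i-1}))`, for the partitions `K_i` given by the first `i`
messages. -/
noncomputable def weightedEntropy (d : ℕ) (K : ℕ → Setoid Ω) (k : ℕ) : ℝ :=
  ∑ i ∈ range k, T d (i + 1) * (entropy (K (i + 1)) - entropy (K i))

lemma weightedEntropy_succ (d : ℕ) (K : ℕ → Setoid Ω) (k : ℕ) :
    weightedEntropy d K (k + 1) =
      weightedEntropy d K k + T d (k + 1) * (entropy (K (k + 1)) - entropy (K k)) :=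
  sum_range_succ ..

lemma T_mul_meanEntropy_succ_le (hWS : IsExactRepair W S) (L : Setoid Ω) (hk : k + 1 < d) :
    T d (k + 2) * (meanEntropy S (fun _ => L) (k + 2) - entropy L) ≤
      T d (k + 1) * (meanEntropy S (fun _ => L) (k + 1) - entropy L) := by
  have := T_mul_help_succ_le (fun j => meanEntropy_const_succ_sub_le hWS L)
    (fun j => mul_meanEntropy_content_succ_sub_le hWS L) hk
  rwa [meanEntropy_const_zero] at this

lemma meanEntropy_content_succ_sub_le (hWS : IsExactRepair W S) (L : Setoid Ω) (hk : k < d) :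
    meanEntropy S (fun i => L ⊓ W i) (k + 1) - meanEntropy S (fun i => L ⊓ W i) k ≤
      ((d : ℝ) - k - 1) *
        (T d (k + 1) * (meanEntropy S (fun _ => L) (k + 1) - entropy L)) := by
  have := content_succ_sub_le (fun j => meanEntropy_const_succ_sub_le hWS L)
    (fun j => mul_meanEntropy_content_succ_sub_le hWS L) hk
  rwa [meanEntropy_const_zero] at this

lemma entropy_incoming_le (hS : ∀ i j, j ≠ i → entropy (S j i) ≤ β) (i : Fin (d + 1)) :
    entropy (incoming S i) ≤ d * β := by
  have subadditive := condEntropy_biInf_le_sum (fun j => S j i) ⊤ (univ.erase i)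
  simp only [condEntropy, inf_top_eq, entropy_top, sub_zero, mem_erase, mem_univ,
    and_true] at subadditive
  calc entropy (incoming S i) ≤ ∑ j ∈ univ.erase i, entropy (S j i) := subadditive
    _ ≤ #(univ.erase i) • β := sum_le_card_nsmul _ _ β fun j hj => hS i j (ne_of_mem_erase hj)
    _ = d * β := by simp

lemma IsMultilevelRepair.meanEntropy_help_eq (h : IsMultilevelRepair K W S) (hk : k < d) :
    meanEntropy S (fun _ => K (k + 1)) (k + 1) = meanEntropy S (fun _ => K k) (k + 1) := by
  refine meanEntropy_congr fun π => ?_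
  have hle := h.incomingFirst_le hk π
  rw [inf_eq_right.mpr hle, inf_eq_right.mpr (hle.trans (h.antitone k.le_succ))]

lemma IsMultilevelRepair.meanEntropy_content_eq (h : IsMultilevelRepair K W S) (hk : k < d) :
    meanEntropy S (fun i => K (k + 1) ⊓ W i) k = meanEntropy S (fun i => K k ⊓ W i) k := by
  refine meanEntropy_congr fun π => ?_
  have hle := h.content_inf_incomingFirst_le hk π
  rw [inf_assoc, inf_assoc, inf_eq_right.mpr hle,
    inf_eq_right.mpr (hle.trans (h.antitone k.le_succ))]

theorem IsMultilevelRepair.weightedEntropy_add_help_le (h : IsMultilevelRepair K W S)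
    (hS : ∀ i j, j ≠ i → entropy (S j i) ≤ β) (hk : k < d) :
    weightedEntropy d K (k + 1) +
      T d (k + 1) * (meanEntropy S (fun _ => K (k + 1)) (k + 1) - entropy (K (k + 1))) ≤ β := by
  rw [h.meanEntropy_help_eq hk]
  induction k with
  | zero =>
    have first_le : meanEntropy S (fun _ => ⊤) (0 + 1) ≤ d * β := by
      refine (meanEntropy_const_succ ⊤ 0).trans_le (meanEntropy_zero_le fun i => ?_)
      rw [top_inf_eq]
      exact entropy_incoming_le hS i
    have T_one : T d (0 + 1) = (d : ℝ)⁻¹ := by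
      rw [T_eq_inv_repairCount hk, repairCount_one]
    rw [weightedEntropy, sum_range_one, ← mul_add, h.zero_eq_top, entropy_top, T_one,
      inv_mul_le_iff₀ (Nat.cast_pos.mpr hk)]
    linarith
  | succ k ih =>
    have hk' := Nat.lt_of_succ_lt hk
    have help_le := T_mul_meanEntropy_succ_le h.toIsExactRepair (K (k + 1)) hk
    rw [h.meanEntropy_help_eq hk'] at help_le
    rw [weightedEntropy_succ]
    linarith [ih hk']

theorem IsMultilevelRepair.repairCount_mul_weightedEntropy_add_content_le
    (h : IsMultilevelRepair K W S) (hS : ∀ i j, j ≠ i → entropy (S j i) ≤ β)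
    (hW : ∀ i, entropy (W i) ≤ α) (hk : k < d) :
    repairCount d (k + 1) * weightedEntropy d K (k + 1) +
        (meanEntropy S (fun i => K (k + 1) ⊓ W i) k - entropy (K (k + 1))) ≤
      α + (repairCount d (k + 1) - d) * β := by
  induction k with
  | zero =>
    have content_le : meanEntropy S (fun i => ⊤ ⊓ W i) 0 ≤ α :=
      meanEntropy_zero_le fun i => by
        rw [top_inf_eq]
        exact hW i
    rw [h.meanEntropy_content_eq hk, weightedEntropy, sum_range_one, ← mul_assoc,
      repairCount_mul_T hk, h.zero_eq_top, entropy_top, zero_add, repairCount_one]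
    linarith
  | succ k ih =>
    have hk' : k < d := Nat.lt_of_succ_lt hk
    have hdk : (0 : ℝ) ≤ d - k - 1 := by
      rw [sub_sub, sub_nonneg]
      exact_mod_cast hk'
    have content_le := meanEntropy_content_succ_sub_le h.toIsExactRepair (K (k + 1)) hk'
    have help_le := mul_le_mul_of_nonneg_left (h.weightedEntropy_add_help_le hS hk') hdk
    rw [h.meanEntropy_content_eq hk, weightedEntropy_succ, mul_add, ← mul_assoc,
      repairCount_mul_T hk, cast_repairCount_succ hk.le]
    push_cast
    linarith [ih hk']

theorem IsMultilevelRepair.entropy_outer_bounds (h : IsMultilevelRepair K W S)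
    (hS : ∀ i j, j ≠ i → entropy (S j i) ≤ β) (hW : ∀ i, entropy (W i) ≤ α) (hd : 0 < d) :
    weightedEntropy d K d ≤ β ∧ J d * weightedEntropy d K d ≤ α + J (d - 1) * β := by
  obtain ⟨k, rfl⟩ : ∃ k, d = k + 1 := ⟨d - 1, by omega⟩
  have help_le := h.weightedEntropy_add_help_le hS k.lt_succ_self
  have content_le := h.repairCount_mul_weightedEntropy_add_content_le hS hW k.lt_succ_self
  have entropy_le_help : entropy (K (k + 1)) ≤ meanEntropy S (fun _ => K (k + 1)) (k + 1) :=
    le_meanEntropy fun π => entropy_anti inf_le_left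
  have entropy_le_content : entropy (K (k + 1)) ≤ meanEntropy S (fun i => K (k + 1) ⊓ W i) k :=
    le_meanEntropy fun π => entropy_anti (inf_le_left.trans inf_le_left)
  have := mul_nonneg (T_succ_nonneg k.lt_succ_self) (sub_nonneg.mpr entropy_le_help)
  rw [J_pred, J_eq_repairCount]
  exact ⟨by linarith, by linarith⟩

end OuterBounds

section MessagePartitions

variable {d : ℕ} {M : Fin d → Type}

/-- The partition given by the first `k` messages. -/
def messagesBefore (M : Fin d → Type) (k : ℕ) : Setoid (∀ l, M l) where
  r x y := ∀ l : Fin d, (l : ℕ) < k → x l = y l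
  iseqv := ⟨fun _ _ _ => rfl, fun h l hl => (h l hl).symm,
    fun h h' l hl => (h l hl).trans (h' l hl)⟩

lemma messagesBefore_zero : messagesBefore M 0 = ⊤ :=
  top_unique fun _ _ _ _ hl => absurd hl (Nat.not_lt_zero _)

lemma messagesBefore_antitone : Antitone (messagesBefore M) :=
  fun _ _ hk _ _ h l hl => h l (hl.trans_le hk)

variable [∀ l, Finite (M l)] [∀ l, Nonempty (M l)] [Fintype (∀ l, M l)]

lemma card_div_classSize_messagesBefore (k : ℕ) (x : ∀ l, M l) :
    Fintype.card (∀ l, M l) / classSize (messagesBefore M k) x =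
      ∏ l : Fin d with l.val < k, (Nat.card (M l) : ℝ) := by
  classical
  have := fun l => Fintype.ofFinite (M l)
  have class_eq : (univ.filter fun y => messagesBefore M k x y) =
      Fintype.piFinset fun l : Fin d => if (l : ℕ) < k then {x l} else univ := by
    ext y
    simp only [mem_filter, mem_univ, true_and, Fintype.mem_piFinset]
    refine forall_congr' fun l => ?_
    split_ifs with hl <;> simp [hl, eq_comm]
  have classSize_eq : classSize (messagesBefore M k) x =
      ∏ l : Fin d, if (l : ℕ) < k then 1 else (Nat.card (M l) : ℝ) := by
    rw [classSize, show (Finset.univ.filter fun y => messagesBefore M k x y) = _ from class_eq,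
      Fintype.card_piFinset, Nat.cast_prod]
    refine prod_congr rfl fun l _ => ?_
    split_ifs <;> simp [Nat.card_eq_fintype_card]
  rw [classSize_eq, ← Nat.card_eq_fintype_card, Nat.card_pi, Nat.cast_prod, ← prod_div_distrib,
    prod_filter]
  refine prod_congr rfl fun l _ => ?_
  split_ifs
  · exact div_one _
  · exact div_self (Nat.cast_ne_zero.mpr Nat.card_pos.ne')

lemma entropy_messagesBefore (k : ℕ) :
    entropy (messagesBefore M k) = ∑ l : Fin d with l.val < k, bits (M l) := by
  rw [entropy, expect_congr rfl fun x _ => by rw [card_div_classSize_messagesBefore],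
    Fintype.expect_const,
    Real.logb_prod _ _ fun l _ => Nat.cast_ne_zero.mpr (Nat.card_pos (α := M l)).ne']
  rfl

lemma weightedEntropy_messagesBefore :
    weightedEntropy d (messagesBefore M) d = ∑ l : Fin d, T d (l + 1) * bits (M l) := by
  have increment (l : Fin d) :
      entropy (messagesBefore M (l + 1)) - entropy (messagesBefore M l) = bits (M l) := by
    have insert_eq : (univ.filter fun j : Fin d => (j : ℕ) < l + 1) =
        insert l (univ.filter fun j : Fin d => (j : ℕ) < l) := by
      ext j
      simp only [mem_filter, mem_univ, true_and, mem_insert, Fin.ext_iff]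
      omega
    rw [entropy_messagesBefore, entropy_messagesBefore, insert_eq, sum_insert (by simp),
      add_sub_cancel_right]
  rw [weightedEntropy, sum_range]
  exact sum_congr rfl fun l _ => by rw [increment l]

end MessagePartitions

section MLDRConverse

variable {n d : ℕ} {M : Fin d → Type} {W S : Type}

/-- The helpers for the repair of node `i` among the first `d + 1` nodes. -/
def helpersOf (hdn : d < n) (i : Fin (d + 1)) : Finset (Fin n) :=
  (univ.erase i).map (Fin.castLEEmb hdn)

lemma castLE_mem_helpersOf (hdn : d < n) {i j : Fin (d + 1)} :
    Fin.castLE hdn j ∈ helpersOf hdn i ↔ j ≠ i := by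
  simp [helpersOf]

lemma card_helpersOf (hdn : d < n) (i : Fin (d + 1)) : #(helpersOf hdn i) = d := by
  simp [helpersOf]

/-- The partition given by the content of node `i`, for the first `d + 1` nodes. -/
def MLDRCode.contentPartition (C : MLDRCode n d M W S) (hdn : d < n) (i : Fin (d + 1)) :
    Setoid (∀ l, M l) :=
  Setoid.ker (C.enc (Fin.castLE hdn i))

/-- The partition given by what node `j` sends for the repair of node `i` by the other nodes among
the first `d + 1`; it is trivial for `j = i`. -/
def MLDRCode.helpPartition (C : MLDRCode n d M W S) (hdn : d < n) (j i : Fin (d + 1)) :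
    Setoid (∀ l, M l) :=
  ⨅ hj : j ≠ i, Setoid.ker fun m => C.help (Fin.castLE hdn i) (helpersOf hdn i)
    ⟨Fin.castLE hdn j, (castLE_mem_helpersOf hdn).mpr hj⟩ (C.enc (Fin.castLE hdn j) m)

lemma MLDRCode.isExactRepair (C : MLDRCode n d M W S) (hdn : d < n) :
    IsExactRepair (C.contentPartition hdn) (C.helpPartition hdn) where
  content_le_help _ := le_iInf fun _ _ _ h => congrArg (C.help _ _ _) h
  incoming_le_content i x y hxy := by
    change C.enc _ x = C.enc _ y
    have notMem : Fin.castLE hdn i ∉ helpersOf hdn i := by simp [castLE_mem_helpersOf]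
    rw [← C.regeneration _ _ (card_helpersOf hdn i) notMem x,
      ← C.regeneration _ _ (card_helpersOf hdn i) notMem y]
    congr 1
    funext ⟨v, hv⟩
    obtain ⟨j, hj, rfl⟩ := mem_map.mp hv
    have hji := ne_of_mem_erase hj
    have hle := (incoming_le_help (C.helpPartition hdn) hji).trans (iInf_le _ hji)
    exact hle hxy

lemma MLDRCode.isMultilevelRepair (C : MLDRCode n d M W S) (hdn : d < n) :
    IsMultilevelRepair (messagesBefore M) (C.contentPartition hdn) (C.helpPartition hdn) where
  toIsExactRepair := C.isExactRepair hdn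
  zero_eq_top := messagesBefore_zero
  antitone := messagesBefore_antitone
  recovers _ _ A hA x y hxy l hl := by
    obtain ⟨B, hBA, hB⟩ := exists_subset_card_eq (by omega : (l : ℕ) + 1 ≤ #A)
    have hB' : #(B.map (Fin.castLEEmb hdn)) = l + 1 := by rw [card_map, hB]
    rw [← C.reconstruction l _ hB' x, ← C.reconstruction l _ hB' y]
    congr 1
    funext ⟨v, hv⟩
    obtain ⟨i, hi, rfl⟩ := mem_map.mp hv
    have hle : ⨅ i ∈ A, C.contentPartition hdn i ≤ C.contentPartition hdn i := iInf₂_le i (hBA hi)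
    exact hle hxy

theorem MLDRCode.outer_bounds [∀ l, Finite (M l)] [∀ l, Nonempty (M l)] [Finite W] [Finite S]
    (C : MLDRCode n d M W S) (hd : 0 < d) (hdn : d < n) :
    ∑ l : Fin d, T d (l + 1) * bits (M l) ≤ bits S ∧
      J d * ∑ l : Fin d, T d (l + 1) * bits (M l) ≤ bits W + J (d - 1) * bits S := by
  have := Fintype.ofFinite (∀ l, M l)
  rw [← weightedEntropy_messagesBefore]
  refine (C.isMultilevelRepair hdn).entropy_outer_bounds (fun i j hji => ?_)
    (fun i => entropy_ker_le_bits _) hd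
  simp only [helpPartition, iInf_pos hji]
  exact entropy_ker_le_bits _

end MLDRConverse

section Bits

variable {A B : Type}

lemma bits_pos [Finite A] [Nontrivial A] : 0 < bits A :=
  Real.logb_pos one_lt_two (Nat.one_lt_cast.mpr Finite.one_lt_card)

lemma bits_congr (e : A ≃ B) : bits A = bits B := by
  rw [bits, Nat.card_congr e, bits]

lemma bits_fun {ι : Type} [Finite ι] : bits (ι → A) = Nat.card ι * bits A := by
  rw [bits, Nat.card_fun, Nat.cast_pow, Real.logb_pow, bits]

lemma bits_pi_le {ι : Type} [Fintype ι] (A : ι → Type) : bits (∀ i, A i) ≤ ∑ i, bits (A i) := by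
  by_cases h : ∃ i, Nat.card (A i) = 0
  · obtain ⟨i, hi⟩ := h
    rw [bits, Nat.card_pi, prod_eq_zero (mem_univ i) hi, Nat.cast_zero, Real.logb_zero]
    exact sum_nonneg fun i _ => bits_nonneg (A i)
  · push Not at h
    rw [bits, Nat.card_pi, Nat.cast_prod, Real.logb_prod _ _ fun i _ => Nat.cast_ne_zero.mpr (h i)]
    rfl

end Bits

section ProductMatrix

open Matrix
open scoped Polynomial

variable {R : Type} [CommRing R] {ι : Type*} {n d k : ℕ} {x : ι → R} {A : Finset ι}

/-- Chinese remainders reduce this to finite fields. -/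
lemma exists_commRing_isUnit_sub {n t q : ℕ} (ht : t ≠ 0) (hnt : n ≤ t) (hq : q ≠ 0) :
    ∃ (R : Type) (_ : CommRing R) (_ : Finite R) (x : Fin n → R),
      Nat.card R = q ^ t ∧ Pairwise fun i j => IsUnit (x i - x j) := by
  induction q using Nat.recOnMul with
  | zero => exact absurd rfl hq
  | one => exact ⟨PUnit, inferInstance, inferInstance, 0, by simp,
      fun _ _ _ => isUnit_of_subsingleton _⟩
  | prime p hp =>
    have : Fact p.Prime := ⟨hp⟩
    have hcard := GaloisField.card p t ht
    have := Fintype.ofFinite (GaloisField p t)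
    obtain ⟨x⟩ : Nonempty (Fin n ↪ GaloisField p t) := by
      apply Function.Embedding.nonempty_of_card_le
      rw [Fintype.card_fin, ← Nat.card_eq_fintype_card, hcard]
      exact hnt.trans (Nat.lt_pow_self hp.one_lt).le
    exact ⟨GaloisField p t, inferInstance, inferInstance, x, hcard, fun i j hij =>
      (sub_ne_zero.mpr (x.injective.ne hij)).isUnit⟩
  | mul a b iha ihb =>
    obtain ⟨R, _, _, x, hR, hx⟩ := iha (left_ne_zero_of_mul hq)
    obtain ⟨R', _, _, y, hR', hy⟩ := ihb (right_ne_zero_of_mul hq)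
    exact ⟨R × R', inferInstance, inferInstance, fun i => (x i, y i),
      by rw [Nat.card_prod, hR, hR', mul_pow],
      fun i j hij => Prod.isUnit_iff.mpr ⟨hx hij, hy hij⟩⟩

lemma eq_zero_of_degree_lt_of_eval_eq_zero (hx : Pairwise fun i j => IsUnit (x i - x j))
    {p : R[X]} (hdeg : p.degree < #A) (heval : ∀ i ∈ A, p.eval (x i) = 0) : p = 0 := by
  nontriviality R
  have hdvd : ∏ i ∈ A, (Polynomial.X - Polynomial.C (x i)) ∣ p :=
    prod_dvd_of_coprime
      (fun i _ j _ hij => Polynomial.isCoprime_X_sub_C_of_isUnit_sub (hx hij))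
      fun i hi => Polynomial.dvd_iff_isRoot.mpr (heval i hi)
  by_contra hp
  refine (Polynomial.monic_prod_X_sub_C x A).not_dvd_of_degree_lt hp ?_ hdvd
  rwa [Polynomial.degree_prod_of_monic _ _ fun i _ => Polynomial.monic_X_sub_C _,
    sum_congr rfl fun i _ => Polynomial.degree_X_sub_C _, sum_const, nsmul_one]

/-- The vector `(1, y, …, y ^ (d - 1))`. -/
def powers (d : ℕ) (y : R) : Fin d → R := fun a => y ^ (a : ℕ)

lemma eq_zero_of_dotProduct_powers_eq_zero (hx : Pairwise fun i j => IsUnit (x i - x j))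
    {c : Fin d → R} (hc : ∀ a : Fin d, #A ≤ a → c a = 0)
    (h : ∀ i ∈ A, c ⬝ᵥ powers d (x i) = 0) : c = 0 := by
  classical
  let p : R[X] := Polynomial.ofFn d c
  have hcoeff (a : Fin d) : p.coeff a = c a := Polynomial.ofFn_coeff_eq_val_of_lt c a.2
  have hdeg : p.degree < #A := by
    refine (Polynomial.degree_lt_iff_coeff_zero _ _).mpr fun a ha => ?_
    obtain had | had := lt_or_ge a d
    · exact (hcoeff ⟨a, had⟩).trans (hc ⟨a, had⟩ ha)
    · exact Polynomial.ofFn_coeff_eq_zero_of_ge c had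
  have heval (y : R) : p.eval y = c ⬝ᵥ powers d y := by
    simp [p, Polynomial.ofFn_eq_sum_monomial, Polynomial.eval_finsetSum, dotProduct, powers]
  have hp : p = 0 :=
    eq_zero_of_degree_lt_of_eval_eq_zero hx hdeg fun i hi => (heval _).trans (h i hi)
  funext a
  rw [← hcoeff, hp, Polynomial.coeff_zero, Pi.zero_apply]

variable {D : Matrix (Fin d) (Fin d) R}

lemma eq_zero_of_isSymm_of_mulVec_powers_eq_zero (hD : D.IsSymm)
    (hx : Pairwise fun i j => IsUnit (x i - x j))
    (hzero : ∀ a b : Fin d, #A ≤ a → #A ≤ b → D a b = 0)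
    (h : ∀ i ∈ A, D *ᵥ powers d (x i) = 0) : D = 0 := by
  have row_eq_zero (a : Fin d) (ha : ∀ b : Fin d, #A ≤ b → D a b = 0) : D a = 0 :=
    eq_zero_of_dotProduct_powers_eq_zero hx ha fun i hi => congrFun (h i hi) a
  refine funext fun a => row_eq_zero a fun b hb => ?_
  rw [← hD.apply, row_eq_zero b fun c hc => hzero b c hb hc, Pi.zero_apply]

lemma mulVec_powers_eq_zero_of_isSymm (hD : D.IsSymm)
    (hx : Pairwise fun i j => IsUnit (x i - x j)) (hA : #A = d) {y : R}
    (h : ∀ i ∈ A, powers d y ⬝ᵥ D *ᵥ powers d (x i) = 0) : D *ᵥ powers d y = 0 := by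
  refine eq_zero_of_dotProduct_powers_eq_zero (A := A) hx
    (fun a ha => absurd (hA ▸ ha) a.2.not_ge) fun i hi => ?_
  rw [← h i hi, dotProduct_mulVec, ← mulVec_transpose, hD.eq]

/-- The positions of the free entries of a symmetric `d × d` matrix which vanishes outside its first
`k` rows and columns; positions `(a, b)` and `(b, a)` are identified. -/
def freeEntries (d k : ℕ) : Finset (Sym2 (Fin d)) :=
  (({a | a.val < k} : Finset (Fin d))ᶜ.sym2)ᶜ

lemma mk_mem_freeEntries {a b : Fin d} :
    s(a, b) ∈ freeEntries d k ↔ (a : ℕ) < k ∨ (b : ℕ) < k := by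
  simp only [freeEntries, mem_compl, mk_mem_sym2_iff, mem_filter, mem_univ, true_and]
  tauto

lemma repairCount_add_choose (hk : k ≤ d) :
    repairCount d k + (d - k + 1).choose 2 = (d + 1).choose 2 := by
  induction k with
  | zero => simp [repairCount]
  | succ k ih =>
    have choose_succ : (d - k + 1).choose 2 = (d - k) + (d - (k + 1) + 1).choose 2 := by
      rw [Nat.choose_succ_succ', Nat.choose_one_right, show d - (k + 1) + 1 = d - k by omega]
    rw [← ih (Nat.le_of_succ_le hk), choose_succ, repairCount, sum_range_succ, ← repairCount]
    ring

lemma card_freeEntries (hk : k ≤ d) : Nat.card (freeEntries d k) = repairCount d k := by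
  rw [Nat.card_eq_fintype_card, Fintype.card_coe, freeEntries, card_compl, card_sym2, card_compl,
    Fin.card_filter_val_lt, Sym2.card, Fintype.card_fin, min_eq_right hk,
    ← repairCount_add_choose hk, Nat.add_sub_cancel]

/-- The symmetric matrix with the symbols of the message `m` at its free entries. -/
def messageMatrix (m : freeEntries d k → R) : Matrix (Fin d) (Fin d) R :=
  Matrix.of fun a b => if h : s(a, b) ∈ freeEntries d k then m ⟨s(a, b), h⟩ else 0

lemma messageMatrix_isSymm (m : freeEntries d k → R) : (messageMatrix m).IsSymm := by
  ext a b
  simp only [messageMatrix, transpose_apply, of_apply, Sym2.eq_swap]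

lemma messageMatrix_eq_zero (m : freeEntries d k → R) {a b : Fin d} (ha : k ≤ a) (hb : k ≤ b) :
    messageMatrix m a b = 0 :=
  dif_neg (by rw [mk_mem_freeEntries]; omega)

lemma messageMatrix_injective :
    Function.Injective (messageMatrix : (freeEntries d k → R) → Matrix (Fin d) (Fin d) R) := by
  rintro m m' h
  funext ⟨z, hz⟩
  induction z with
  | h a b => simpa [messageMatrix, hz] using congrFun₂ h a b

lemma eq_of_messageMatrix_mulVec_powers_eq (hx : Pairwise fun i j => IsUnit (x i - x j))
    (hA : #A = k) {m m' : freeEntries d k → R}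
    (h : ∀ i ∈ A, messageMatrix m *ᵥ powers d (x i) = messageMatrix m' *ᵥ powers d (x i)) :
    m = m' := by
  subst hA
  refine messageMatrix_injective (sub_eq_zero.mp (eq_zero_of_isSymm_of_mulVec_powers_eq_zero
    (A := A) ((messageMatrix_isSymm m).sub (messageMatrix_isSymm m')) hx (fun a b ha hb => ?_)
    fun i hi => ?_))
  · rw [Matrix.sub_apply, messageMatrix_eq_zero m ha hb, messageMatrix_eq_zero m' ha hb, sub_zero]
  · rw [sub_mulVec, h i hi, sub_self]

lemma messageMatrix_mulVec_powers_eq (hx : Pairwise fun i j => IsUnit (x i - x j))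
    (hA : #A = d) {m m' : freeEntries d k → R} {y : R}
    (h : ∀ i ∈ A, powers d y ⬝ᵥ messageMatrix m *ᵥ powers d (x i) =
      powers d y ⬝ᵥ messageMatrix m' *ᵥ powers d (x i)) :
    messageMatrix m *ᵥ powers d y = messageMatrix m' *ᵥ powers d y := by
  rw [← sub_eq_zero, ← sub_mulVec]
  refine mulVec_powers_eq_zero_of_isSymm
    ((messageMatrix_isSymm m).sub (messageMatrix_isSymm m')) hx hA fun i hi => ?_
  rw [sub_mulVec, dotProduct_sub, h i hi, sub_self]

/-- The regenerating code obtained from an encoder and helper functions such that node contents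
determine the message, and helper data the content of the failed node. -/
noncomputable def RegeneratingCode.ofDetermines {M W S : Type} [Nonempty M]
    (enc : Fin n → M → W) (help : (i : Fin n) → (A : Finset (Fin n)) → A → W → S)
    (hdec : ∀ A : Finset (Fin n), #A = k → ∀ m m', (∀ i ∈ A, enc i m = enc i m') → m = m')
    (hrep : ∀ (i : Fin n) (A : Finset (Fin n)), #A = d → ∀ m m',
      (∀ j : A, help i A j (enc j m) = help i A j (enc j m')) → enc i m = enc i m') :
    RegeneratingCode n k d M W S where
  enc := enc
  dec A := Function.invFun fun m (j : A) => enc j m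
  help := help
  repair i A s := enc i (Function.invFun (fun m (j : A) => help i A j (enc j m)) s)
  reconstruction A hA m := hdec A hA _ _ fun i hi =>
    congrFun (Function.invFun_eq (f := fun m (j : A) => enc j m) ⟨m, rfl⟩) ⟨i, hi⟩
  regeneration i A hA _ m := hrep i A hA _ _ fun j =>
    congrFun (Function.invFun_eq (f := fun m (j : A) => help i A j (enc j m)) ⟨m, rfl⟩) j

/-- The product-matrix MBR code of Rashmi, Shah and Kumar: node `i` stores the product of the
message matrix with the vector of powers of `x i`. -/
noncomputable def productMatrixCode {x : Fin n → R} (hx : Pairwise fun i j => IsUnit (x i - x j))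
    (d k : ℕ) : RegeneratingCode n k d (freeEntries d k → R) (Fin d → R) R :=
  .ofDetermines (fun i m => messageMatrix m *ᵥ powers d (x i)) (fun i _ _ w => powers d (x i) ⬝ᵥ w)
    (fun _ hA _ _ h => eq_of_messageMatrix_mulVec_powers_eq hx hA h)
    (fun _ _ hA _ _ h => messageMatrix_mulVec_powers_eq hx hA fun j hj => h ⟨j, hj⟩)

/-- The code that encodes `m` as `C` encodes `e m`. -/
def RegeneratingCode.comapMessage {M M' W S : Type} (C : RegeneratingCode n k d M W S)
    (e : M' ≃ M) : RegeneratingCode n k d M' W S where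
  enc i m := C.enc i (e m)
  dec A w := e.symm (C.dec A w)
  help := C.help
  repair := C.repair
  reconstruction A hA m := by rw [C.reconstruction A hA, e.symm_apply_apply]
  regeneration i A hA hi m := C.regeneration i A hA hi (e m)

/-- The sizes `α = d T_{d,k} B` and `β = T_{d,k} B` of an `(n,k,d)` MBR code, also for messages of
`B = 0` bits. -/
def RegeneratingCode.HasMBRSizes {M W S : Type} (_C : RegeneratingCode n k d M W S) : Prop :=
  bits W = d * T d k * bits M ∧ bits S = T d k * bits M

theorem exists_regeneratingCode_hasMBRSizes {Q : Type} [Finite Q] [Nonempty Q] (hk : k < d)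
    {s : ℕ} (hs : s ≠ 0) (hdvd : n * repairCount d (k + 1) ∣ s) :
    ∃ (W S : Type) (C : RegeneratingCode n (k + 1) d (Fin s → Q) W S),
      Finite W ∧ Finite S ∧ C.HasMBRSizes := by
  obtain ⟨t, rfl⟩ := hdvd
  have ht : t ≠ 0 := right_ne_zero_of_mul hs
  have hn : n ≠ 0 := left_ne_zero_of_mul (left_ne_zero_of_mul hs)
  obtain ⟨R, _, _, x, hR, hx⟩ := exists_commRing_isUnit_sub (n := n) (mul_ne_zero hn ht)
    (Nat.le_mul_of_pos_right n (Nat.pos_of_ne_zero ht)) (Nat.card_pos (α := Q)).ne'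
  have hcard : Nat.card (Fin (n * repairCount d (k + 1) * t) → Q) =
      Nat.card (freeEntries d (k + 1) → R) := by
    rw [Nat.card_fun, Nat.card_fun, hR, ← pow_mul, Nat.card_fin, card_freeEntries hk,
      mul_right_comm]
  obtain ⟨e⟩ := Finite.card_eq.mp hcard
  have bits_block : T d (k + 1) * bits (Fin (n * repairCount d (k + 1) * t) → Q) = bits R := by
    rw [bits_congr e, bits_fun, card_freeEntries hk, ← mul_assoc,
      mul_comm (T d (k + 1)), repairCount_mul_T hk, one_mul]
  exact ⟨_, _, (productMatrixCode hx d (k + 1)).comapMessage e, inferInstance, inferInstance,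
    by rw [mul_assoc, bits_block, bits_fun, Nat.card_fin], bits_block.symm⟩

end ProductMatrix

section Regions

variable {n d : ℕ}

lemma weightedSize_normalizedSizes {M : Fin d → Type} (hB : 0 < ∑ k, bits (M k)) :
    weightedSize (normalizedSizes M) * ∑ k, bits (M k) =
      ∑ k : Fin d, T d (k + 1) * bits (M k) := by
  rw [weightedSize, sum_mul]
  exact sum_congr rfl fun k _ => by rw [normalizedSizes, mul_assoc, div_mul_cancel₀ _ hB.ne']

theorem mldrRegion_outer_bounds (hd : 0 < d) (hdn : d < n) {Bbar : Fin d → ℝ} {p : ℝ × ℝ}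
    (hp : p ∈ mldrRegion n d Bbar) :
    weightedSize Bbar ≤ p.2 ∧ J d * weightedSize Bbar ≤ p.1 + J (d - 1) * p.2 := by
  obtain ⟨M, W, S, C, hM, hW, hS, hB, hBbar, hα, hβ⟩ := hp
  have := fun k => (hM k).1
  have := fun k => (hM k).2
  obtain rfl : Bbar = normalizedSizes M := funext hBbar
  obtain ⟨bound_S, bound_WS⟩ := C.outer_bounds hd hdn
  rw [← weightedSize_normalizedSizes hB] at bound_S bound_WS
  refine ⟨le_of_mul_le_mul_right (bound_S.trans hβ) hB, le_of_mul_le_mul_right ?_ hB⟩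
  linarith [mul_le_mul_of_nonneg_left hβ (J_nonneg (d - 1))]

/-- A regenerating code, as an MLDR code whose messages other than the one with index `k` are
trivial. -/
def RegeneratingCode.toMLDRCode {M W S : Type} {k : Fin d}
    (C : RegeneratingCode n (k + 1) d M W S) : MLDRCode n d (fun l => l = k → M) W S where
  enc i m := C.enc i (m k rfl)
  dec _ A w := fun _ => C.dec A w
  help := C.help
  repair := C.repair
  reconstruction l A hA m := by
    funext rfl
    exact C.reconstruction A hA _
  regeneration i A hA hi m := C.regeneration i A hA hi _

lemma bits_fun_of_prop {p : Prop} [Decidable p] {M : Type} :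
    bits (p → M) = if p then bits M else 0 := by
  by_cases hp : p
  · simpa only [hp, if_true] using bits_congr (Equiv.trueArrowEquiv M)
  · simp [bits, hp]

lemma regeneratingRegion_subset_mldrRegion (k : Fin d) :
    regeneratingRegion n (k + 1) d ⊆ mldrRegion n d (Pi.single k 1) := by
  rintro p ⟨M, W, S, C, hM, hW, hS, hB, hα, hβ⟩
  have sum_bits : ∑ l, bits (l = k → M) = bits M := by
    simp [bits_fun_of_prop]
  have : Nonempty M := not_isEmpty_iff.mp fun _ => hB.ne' (by simp [bits])
  refine ⟨_, W, S, C.toMLDRCode, fun l => ⟨inferInstance, inferInstance⟩, hW, hS,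
    by rwa [sum_bits], fun l => ?_, by rwa [sum_bits], by rwa [sum_bits]⟩
  rw [normalizedSizes, sum_bits, bits_fun_of_prop, Pi.single_apply, ite_div, div_self hB.ne',
    zero_div]

lemma weightedSize_single (k : Fin d) : weightedSize (Pi.single k 1) = T d (k + 1) := by
  simp [weightedSize, Pi.single_apply]

theorem regeneratingRegion_outer_bounds (hd : 0 < d) (hdn : d < n) {k : Fin d} {p : ℝ × ℝ}
    (hp : p ∈ regeneratingRegion n (k + 1) d) :
    T d (k + 1) ≤ p.2 ∧ J d * T d (k + 1) ≤ p.1 + J (d - 1) * p.2 := by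
  rw [← weightedSize_single]
  exact mldrRegion_outer_bounds hd hdn (regeneratingRegion_subset_mldrRegion k hp)

lemma outer_bounds_tight_iff {c : ℝ} {p : ℝ × ℝ} :
    p.2 = c ∧ p.1 + J (d - 1) * p.2 = J d * c ↔ p = (d * c, c) := by
  rw [J_pred, Prod.ext_iff, and_comm, and_congr_left_iff]
  rintro rfl
  constructor <;> intro h <;> linarith

lemma isMBRPoint_of_outer_bounds {X : Set (ℝ × ℝ)} {c : ℝ} (hmem : ((d : ℝ) * c, c) ∈ X)
    (hbound : ∀ q ∈ X, c ≤ q.2 ∧ J d * c ≤ q.1 + J (d - 1) * q.2) :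
    IsMBRPoint X ((d : ℝ) * c, c) := by
  refine ⟨hmem, fun q hq => ⟨(hbound q hq).1, fun (h : q.2 = c) => ?_⟩⟩
  have bound := (hbound q hq).2
  rw [h, J_pred] at bound
  exact le_of_sub_nonneg (by linarith)

end Regions

section SeparateCoding

variable {n d : ℕ}

theorem RegeneratingCode.HasMBRSizes.achieves {k : ℕ} {M W S : Type} [Finite M] [Finite W]
    [Finite S] {C : RegeneratingCode n k d M W S} (hC : C.HasMBRSizes) (hB : 0 < bits M) :
    C.Achieves (d * T d k, T d k) :=
  ⟨inferInstance, inferInstance, inferInstance, hB, hC.1.le, hC.2.le⟩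

theorem isMBRPoint_regeneratingRegion (hd : 0 < d) (hdn : d < n) (k : Fin d) :
    IsMBRPoint (regeneratingRegion n (k + 1) d) (d * T d (k + 1), T d (k + 1)) := by
  have hs : n * repairCount d (k + 1) ≠ 0 :=
    mul_ne_zero (by omega) (repairCount_succ_pos k.2).ne'
  have : Nonempty (Fin (n * repairCount d (k + 1))) := ⟨⟨0, Nat.pos_of_ne_zero hs⟩⟩
  obtain ⟨W, S, C, _, _, hC⟩ :=
    exists_regeneratingCode_hasMBRSizes (Q := Bool) k.2 hs dvd_rfl
  exact isMBRPoint_of_outer_bounds ⟨_, W, S, C, hC.achieves bits_pos⟩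
    fun q => regeneratingRegion_outer_bounds hd hdn

theorem RegeneratingCode.HasMBRSizes.isMBR (hd : 0 < d) (hdn : d < n) {k : Fin d} {M W S : Type}
    [Finite M] [Finite W] [Finite S] {C : RegeneratingCode n (k + 1) d M W S}
    (hC : C.HasMBRSizes) (hB : 0 < bits M) : C.IsMBR := by
  have normalized_pair : (bits W / bits M, bits S / bits M) = (d * T d (k + 1), T d (k + 1)) := by
    rw [hC.1, hC.2, mul_div_cancel_right₀ _ hB.ne', mul_div_cancel_right₀ _ hB.ne']
  rw [IsMBR, normalized_pair]
  exact ⟨hC.achieves hB, isMBRPoint_regeneratingRegion hd hdn k⟩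

theorem separateCode_achieves {M W S : Fin d → Type} [∀ k, Finite (M k)] [∀ k, Nonempty (M k)]
    [∀ k, Finite (W k)] [∀ k, Finite (S k)] (hB : 0 < ∑ k, bits (M k))
    (C : ∀ k : Fin d, RegeneratingCode n (k + 1) d (M k) (W k) (S k))
    (hC : ∀ k, (C k).HasMBRSizes) :
    (separateCode C).Achieves (normalizedSizes M)
      (d * weightedSize (normalizedSizes M), weightedSize (normalizedSizes M)) := by
  refine ⟨fun k => ⟨inferInstance, inferInstance⟩, inferInstance, inferInstance, hB,
    fun _ => rfl, ?_, ?_⟩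
  · calc bits (∀ k, W k) ≤ ∑ k, bits (W k) := bits_pi_le W
      _ = ∑ k : Fin d, d * (T d (k + 1) * bits (M k)) :=
        sum_congr rfl fun k _ => (hC k).1.trans (mul_assoc _ _ _)
      _ = d * weightedSize (normalizedSizes M) * ∑ k, bits (M k) := by
        rw [← mul_sum, mul_assoc, weightedSize_normalizedSizes hB]
  · calc bits (∀ k, S k) ≤ ∑ k, bits (S k) := bits_pi_le S
      _ = ∑ k : Fin d, T d (k + 1) * bits (M k) := sum_congr rfl fun k _ => (hC k).2
      _ = weightedSize (normalizedSizes M) * ∑ k, bits (M k) :=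
        (weightedSize_normalizedSizes hB).symm

lemma normalizedSizes_fun {ι : Type} [Finite ι] [Nonempty ι] (M : Fin d → Type) :
    normalizedSizes (fun k => ι → M k) = normalizedSizes M := by
  funext k
  simp only [normalizedSizes, bits_fun, ← mul_sum]
  exact mul_div_mul_left _ _ (Nat.cast_ne_zero.mpr Nat.card_pos.ne')

end SeparateCoding

end MLDR

theorem mainTheorem2 (n d : ℕ) (hd : 1 ≤ d) (hdn : d < n)
    (M : Fin d → Type) (hfin : ∀ k, Finite (M k)) (hne : ∀ k, Nonempty (M k))
    (hM : ∃ k, Nontrivial (M k)) :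
    -- separate coding of blocks of `s` messages with MBR codes achieves the pair
    (∃ s : ℕ, 1 ≤ s ∧ ∃ (W S : Fin d → Type)
      (C : ∀ k : Fin d,
        MLDR.RegeneratingCode n ((k : ℕ) + 1) d (Fin s → M k) (W k) (S k)),
      (∀ k, Finite (W k) ∧ Finite (S k) ∧
        MLDR.bits (W k) = d * MLDR.T d ((k : ℕ) + 1) * MLDR.bits (Fin s → M k) ∧
        MLDR.bits (S k) = MLDR.T d ((k : ℕ) + 1) * MLDR.bits (Fin s → M k)) ∧
      (∀ k, Nontrivial (M k) → (C k).IsMBR) ∧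
      (MLDR.separateCode C).Achieves (MLDR.normalizedSizes M)
        (d * MLDR.weightedSize (MLDR.normalizedSizes M),
          MLDR.weightedSize (MLDR.normalizedSizes M))) ∧
    -- the MBR point of each individual exact-repair problem
    (∀ k : Fin d, MLDR.IsMBRPoint (MLDR.regeneratingRegion n ((k : ℕ) + 1) d)
      (d * MLDR.T d ((k : ℕ) + 1), MLDR.T d ((k : ℕ) + 1))) ∧
    -- the two outer bounds
    (∀ p ∈ MLDR.mldrRegion n d (MLDR.normalizedSizes M),
      MLDR.weightedSize (MLDR.normalizedSizes M) ≤ p.2 ∧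
      MLDR.J d * MLDR.weightedSize (MLDR.normalizedSizes M) ≤ p.1 + MLDR.J (d - 1) * p.2) ∧
    -- the pair is the unique point at which both bounds hold with equality
    (∀ p : ℝ × ℝ,
      (p.2 = MLDR.weightedSize (MLDR.normalizedSizes M) ∧
        p.1 + MLDR.J (d - 1) * p.2 = MLDR.J d * MLDR.weightedSize (MLDR.normalizedSizes M)) ↔
      p = (d * MLDR.weightedSize (MLDR.normalizedSizes M),
        MLDR.weightedSize (MLDR.normalizedSizes M))) ∧
    -- the pair is the MBR point of the MLDR problem
    MLDR.IsMBRPoint (MLDR.mldrRegion n d (MLDR.normalizedSizes M))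
      (d * MLDR.weightedSize (MLDR.normalizedSizes M),
        MLDR.weightedSize (MLDR.normalizedSizes M)) := by
  let s : ℕ := n * ∏ k : Fin d, MLDR.repairCount d (k + 1)
  have hs : s ≠ 0 := mul_ne_zero (by omega)
    (Finset.prod_ne_zero_iff.mpr fun k _ => (MLDR.repairCount_succ_pos k.2).ne')
  have : Nonempty (Fin s) := ⟨⟨0, Nat.pos_of_ne_zero hs⟩⟩
  choose W S C hW hS hC using fun k : Fin d =>
    MLDR.exists_regeneratingCode_hasMBRSizes (Q := M k) k.2 hs
      (mul_dvd_mul_left n (Finset.dvd_prod_of_mem _ (Finset.mem_univ k)))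
  have hB : 0 < ∑ k, MLDR.bits (Fin s → M k) := by
    obtain ⟨k, _⟩ := hM
    exact Finset.sum_pos' (fun k _ => MLDR.bits_nonneg _) ⟨k, Finset.mem_univ k, MLDR.bits_pos⟩
  have separate := MLDR.separateCode_achieves hB C hC
  rw [MLDR.normalizedSizes_fun] at separate
  have outer_bounds := fun (p : ℝ × ℝ) (hp : p ∈ MLDR.mldrRegion n d (MLDR.normalizedSizes M)) =>
    MLDR.mldrRegion_outer_bounds hd hdn hp
  exact ⟨⟨s, Nat.pos_of_ne_zero hs, W, S, C, fun k => ⟨hW k, hS k, hC k⟩,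
      fun k _ => (hC k).isMBR hd hdn MLDR.bits_pos, separate⟩,
    MLDR.isMBRPoint_regeneratingRegion hd hdn, outer_bounds, fun p => MLDR.outer_bounds_tight_iff,
    MLDR.isMBRPoint_of_outer_bounds ⟨_, _, _, _, separate⟩ outer_bounds⟩
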